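/- For positive integers $n$, let $\mathbf 1_n$ be the all ones vector of length $n$ and $\mathbb J_n$ the all ones $n\times n$ matrix. Write $\operatorname{J}_A=X$ to mean that $X$ is a Jordan canonical form of the square matrix $A$ over $\mathbb C$ (a block diagonal matrix of upper Jordan blocks that is similar to $A$; it is determined up to the order of the blocks). Let $M\in\mathbb R^{n\times n}$ and $M'\in\mathbb R^{n'\times n'}$ be irreducible nonnegative matrices with $M\mathbf 1_n=\rho\mathbf 1_n$ and $M'\mathbf 1_{n'}=\rho'\mathbf 1_{n'}$. Let $$\operatorname{J}_M=\begin{bmatrix}\rho & \mathbf 0^T\\ \mathbf 0 & D+N\end{bmatrix},\qquad \operatorname{J}_{M'}=\begin{bmatrix}\rho' & \mathbf 0^T\\ \mathbf 0 & D'+N'\end{bmatrix},$$ where $D\in\mathbb C^{(n-1)\times(n-1)}$ and $D'\in\mathbb C^{(n'-1)\times(n'-1)}$ are diagonal and $N\in\mathbb C^{(n-1)\times(n-1)}$ and $N'\in\mathbb C^{(n'-1)\times(n'-1)}$ are nilpotent. Then $$\operatorname{J}_{M\otimes\mathbb J_{n'}+\mathbb J_n\otimes M'}=\begin{bmatrix}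 n\rho'+n'\rho & \mathbf 0^T & \mathbf 0^T & \mathbf 0^T\\ \mathbf 0 & nD'+N' & O & O\\ \mathbf 0 & O & n'D+N & O\\ \mathbf 0 & O & O & O\end{bmatrix},$$ where the last diagonal block is the zero matrix of order $(n-1)(n'-1)$. -/

import Mathlib

open Matrix
open scoped Kronecker

/-- A square matrix is reducible if some nonempty proper set `S` of indices satisfies `M i j = 0`
for all `i ∈ S`, `j ∉ S`, that is, if a simultaneous permutation of rows and columns brings it to
block triangular form with two nonempty diagonal blocks. It is irreducible otherwise; in particular
every `1 × 1` matrix, including the zero one, is irreducible. -/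
def MatrixIrreducible {n : ℕ} (M : Matrix (Fin n) (Fin n) ℝ) : Prop :=
  ¬ ∃ S : Set (Fin n), S.Nonempty ∧ Sᶜ.Nonempty ∧ ∀ i ∈ S, ∀ j ∈ Sᶜ, M i j = 0

/-- The all ones matrix of order `n`. -/
def allOnes (n : ℕ) : Matrix (Fin n) (Fin n) ℝ :=
  Matrix.of fun _ _ => 1

/-- The matrix `M ⊗ J_{n'} + J_n ⊗ M'`, with `J` the all ones matrix. -/
def boxJ {n n' : ℕ} (M : Matrix (Fin n) (Fin n) ℝ) (M' : Matrix (Fin n') (Fin n') ℝ) :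
    Matrix (Fin n × Fin n') (Fin n × Fin n') ℝ :=
  M ⊗ₖ allOnes n' + allOnes n ⊗ₖ M'

/-- The block diagonal matrix with the two diagonal blocks `A` and `B`, in this order. -/
def dirSum {a b : ℕ} (A : Matrix (Fin a) (Fin a) ℂ) (B : Matrix (Fin b) (Fin b) ℂ) :
    Matrix (Fin (a + b)) (Fin (a + b)) ℂ :=
  Matrix.reindex finSumFinEquiv finSumFinEquiv (Matrix.fromBlocks A 0 0 B)

/-- The Jordan block of size `k` with eigenvalue `μ`: `μ` on the diagonal, `1` on the first
superdiagonal, and `0` elsewhere. -/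
def jordanBlock (k : ℕ) (μ : ℂ) : Matrix (Fin k) (Fin k) ℂ :=
  Matrix.of fun i j => if i = j then μ else if (i : ℕ) + 1 = (j : ℕ) then 1 else 0

/-- A Jordan matrix: a block diagonal matrix whose consecutive diagonal blocks are Jordan blocks of
positive sizes `k 0, k 1, …, k (r - 1)`. -/
def IsJordanMatrix {n : ℕ} (J : Matrix (Fin n) (Fin n) ℂ) : Prop :=
  ∃ (r : ℕ) (k : Fin r → ℕ) (μ : Fin r → ℂ) (h : ∑ i, k i = n), (∀ i, 0 < k i) ∧
    J = Matrix.reindex (finSigmaFinEquiv.trans (finCongr h)) (finSigmaFinEquiv.trans (finCongr h))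
      (Matrix.blockDiagonal' fun i => jordanBlock (k i) (μ i))

/-- `J` is a Jordan canonical form of the real matrix `A`: `J` is a Jordan matrix and
`C⁻¹ A C = J` for some invertible complex matrix `C`. The rows of `C` are indexed as those of `A`
and its columns as those of `J`, and its inverse is given as a matrix `C'`; the two index types
then have equally many elements. -/
def IsJordanForm {ι : Type*} [Fintype ι] [DecidableEq ι] {k : ℕ}
    (A : Matrix ι ι ℝ) (J : Matrix (Fin k) (Fin k) ℂ) : Prop :=
  IsJordanMatrix J ∧
    ∃ (C : Matrix ι (Fin k) ℂ) (C' : Matrix (Fin k) ι ℂ),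
      C * C' = 1 ∧ C' * C = 1 ∧ C' * A.map Complex.ofReal * C = J

/-! Irreducibility makes constants the only eigenvectors of `M` for `ρ`. Hence a Jordan basis can be
changed into one that starts with the all ones vector and continues with zero-sum vectors. There `M`
is block triangular with diagonal blocks `ρ` and `K = D + N`, while the all ones matrix is `n ⊕ 0`
(`exists_simultaneous_block_form`). The Kronecker products then give a matrix with diagonal blocks
`θ = nρ' + n'ρ`, `nK'`, `n'K`, `0`, and off these only the entries `nr'`, `n'r` in the top row.

That row is removed by solving Sylvester equations, possible because `θ/n'` and `θ/n` are at least
`ρ` and `ρ'`, where `K` and `K'` have no eigenvalue (`isUnit_sub_of_similarTo`). Finally `n'(D + N)`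
is diagonally similar to `n'D + N`, which is still a Jordan matrix. -/

/-! ### Jordan matrices described by their entries. -/

/-- The entrywise description of Jordan matrices. -/
def JordanPattern {n : ℕ} (J : Matrix (Fin n) (Fin n) ℂ) : Prop :=
  ∀ i j, J i j ≠ 0 → i ≠ j → (i : ℕ) + 1 = j ∧ J i j = 1 ∧ J i i = J j j

theorem IsJordanMatrix.jordanPattern {n : ℕ} {J : Matrix (Fin n) (Fin n) ℂ}
    (hJ : IsJordanMatrix J) : JordanPattern J := by
  obtain ⟨r, k, μ, h, -, rfl⟩ := hJ
  intro i j hij hne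
  obtain ⟨⟨a, x⟩, rfl⟩ := (finSigmaFinEquiv.trans (finCongr h)).surjective i
  obtain ⟨⟨b, y⟩, rfl⟩ := (finSigmaFinEquiv.trans (finCongr h)).surjective j
  simp only [reindex_apply, submatrix_apply, Equiv.symm_apply_apply] at hij ⊢
  rcases eq_or_ne a b with rfl | hab
  · have hxy : x ≠ y := fun e => hne (by rw [e])
    simp only [blockDiagonal'_apply_eq, jordanBlock, of_apply, hxy, if_false, if_true] at hij ⊢
    split_ifs at hij ⊢ with h1
    · refine ⟨?_, rfl, trivial⟩
      simp only [Equiv.trans_apply, finCongr_apply, Fin.val_cast, finSigmaFinEquiv_apply]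
      omega
    · exact absurd rfl hij
  · exact absurd (blockDiagonal'_apply_ne _ _ _ hab) hij

theorem Composition.sum_blocksFun_castLE {n : ℕ} (c : Composition n) (a : ℕ) (ha : a ≤ c.length) :
    ∑ i : Fin a, c.blocksFun (Fin.castLE ha i) = c.sizeUpTo a := by
  induction a with
  | zero => simp
  | succ a ih =>
    rw [Fin.sum_univ_castSucc, c.sizeUpTo_succ (by omega), ← ih (by omega)]
    rfl

/-- The blocks are recovered by cutting the index range at each zero of the superdiagonal. -/
theorem JordanPattern.isJordanMatrix {n : ℕ} {J : Matrix (Fin n) (Fin n) ℂ}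
    (hJ : JordanPattern J) : IsJordanMatrix J := by
  classical
  let s : CompositionAsSet n :=
    { boundaries := Finset.univ.filter fun p : Fin (n + 1) =>
        ∀ i j : Fin n, (i : ℕ) + 1 = j → (j : ℕ) = p → J i j = 0
      zero_mem := by
        simp only [Finset.mem_filter, Finset.mem_univ, true_and]
        intro i j hij hj
        simp only [Fin.val_zero] at hj
        omega
      getLast_mem := by
        simp only [Finset.mem_filter, Finset.mem_univ, true_and]
        intro i j hij hj
        simp only [Fin.val_last] at hj
        omega }
  let c := s.toComposition
  have hmem : ∀ p : Fin (n + 1), p ∈ c.boundaries ↔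
      ∀ i j : Fin n, (i : ℕ) + 1 = j → (j : ℕ) = p → J i j = 0 := by
    intro p
    rw [show c.boundaries = s.boundaries from s.toComposition_boundaries]
    simp [s]
  have hpos : ∀ a, 0 < c.blocksFun a := fun a => c.one_le_blocksFun a
  have hstart : ∀ a : Fin c.length, ∀ i j : Fin n, (i : ℕ) + 1 = j →
      (j : ℕ) = c.sizeUpTo a → J i j = 0 := by
    intro a
    exact (hmem (c.boundary a.castSucc)).1
      (Finset.mem_map_of_mem _ (Finset.mem_univ a.castSucc))
  have hnext : ∀ (a : Fin c.length) (x y : Fin (c.blocksFun a)), (x : ℕ) + 1 = y →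
      J (c.embedding a x) (c.embedding a y) ≠ 0 := by
    intro a x y hxy h0
    -- A zero here would put a boundary strictly between two consecutive ones.
    have : (c.embedding a y).castSucc ∈ c.boundaries := by
      rw [hmem]
      intro i j hij hj
      have e1 : j = c.embedding a y := Fin.ext hj
      have e2 : i = c.embedding a x := by
        ext
        rw [Fin.val_castSucc] at hj
        rw [c.coe_embedding] at *
        omega
      rw [e1, e2, h0]
    obtain ⟨b, -, hb⟩ := Finset.mem_map.1 this
    have hb' : c.sizeUpTo b = c.sizeUpTo a + y := by
      rw [← c.coe_embedding]
      exact congrArg Fin.val hb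
    have h2 := c.sizeUpTo_succ' a
    rcases le_or_gt (b : ℕ) a with hba | hba
    · have := c.monotone_sizeUpTo hba
      omega
    · have := c.monotone_sizeUpTo (Nat.succ_le_of_lt hba)
      have := y.2
      simp only [Nat.succ_eq_add_one] at *
      omega
  have hdiag : ∀ (a : Fin c.length) (x : ℕ) (hx : x < c.blocksFun a),
      J (c.embedding a ⟨x, hx⟩) (c.embedding a ⟨x, hx⟩) =
        J (c.embedding a ⟨0, hpos a⟩) (c.embedding a ⟨0, hpos a⟩) := by
    intro a x
    induction x with
    | zero => intro hx; rfl
    | succ x ih =>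
      intro hx
      rw [← ih (by omega)]
      refine ((hJ _ _ (hnext a ⟨x, by omega⟩ ⟨x + 1, hx⟩ rfl) ?_).2.2).symm
      exact fun e => by simpa using (c.embedding a).injective e
  refine ⟨c.length, c.blocksFun, fun a => J (c.embedding a ⟨0, hpos a⟩)
    (c.embedding a ⟨0, hpos a⟩), c.sum_blocksFun, hpos, ?_⟩
  set e := finSigmaFinEquiv.trans (finCongr c.sum_blocksFun) with he
  have hee : ∀ a x, e ⟨a, x⟩ = c.embedding a x := by
    intro a x
    ext
    rw [c.coe_embedding, he]
    simp only [Equiv.trans_apply, finCongr_apply, Fin.val_cast, finSigmaFinEquiv_apply]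
    rw [c.sum_blocksFun_castLE]
  rw [← Equiv.symm_apply_eq]
  ext ⟨a, x⟩ ⟨b, y⟩
  simp only [reindex_symm, reindex_apply, submatrix_apply, Equiv.symm_symm, hee]
  rcases eq_or_ne a b with rfl | hab
  · simp only [blockDiagonal'_apply_eq, jordanBlock, of_apply]
    split_ifs with h1 h2
    · subst h1; exact hdiag a x x.2
    · exact (hJ _ _ (hnext a x y h2) fun e => h1 ((c.embedding a).injective e)).2.1
    · by_contra h0
      have := (hJ _ _ h0 fun e => h1 ((c.embedding a).injective e)).1
      rw [c.coe_embedding, c.coe_embedding] at this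
      omega
  · rw [blockDiagonal'_apply_ne _ _ _ hab]
    by_contra h0
    have hne : ∀ x y, c.embedding a x ≠ c.embedding b y := by
      intro x y h
      exact (Set.disjoint_left.1 (c.disjoint_range hab)) ⟨x, rfl⟩ ⟨y, h.symm⟩
    have h1 := (hJ _ _ h0 (hne x y)).1
    -- The column index is the successor of the row index: either it starts block `b`, where the
    -- entry vanishes, or the row index lies in block `b` too.
    rcases Nat.eq_zero_or_pos y with hy | hy
    · refine h0 (hstart b _ _ h1 ?_)
      rw [c.coe_embedding, hy, add_zero]
    · refine hne x ⟨y - 1, by omega⟩ ?_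
      ext
      rw [c.coe_embedding b y] at h1
      rw [c.coe_embedding b]
      simp only
      omega

/-! ### Direct sums and diagonal plus nilpotent decompositions. -/

theorem dirSum_inl_inl {a b : ℕ} (A : Matrix (Fin a) (Fin a) ℂ) (B : Matrix (Fin b) (Fin b) ℂ)
    (i j : Fin a) : dirSum A B (Fin.castAdd b i) (Fin.castAdd b j) = A i j := by
  simp [dirSum]

theorem dirSum_inl_inr {a b : ℕ} (A : Matrix (Fin a) (Fin a) ℂ) (B : Matrix (Fin b) (Fin b) ℂ)
    (i : Fin a) (j : Fin b) : dirSum A B (Fin.castAdd b i) (Fin.natAdd a j) = 0 := by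
  simp [dirSum]

theorem dirSum_inr_inl {a b : ℕ} (A : Matrix (Fin a) (Fin a) ℂ) (B : Matrix (Fin b) (Fin b) ℂ)
    (i : Fin b) (j : Fin a) : dirSum A B (Fin.natAdd a i) (Fin.castAdd b j) = 0 := by
  simp [dirSum]

theorem dirSum_inr_inr {a b : ℕ} (A : Matrix (Fin a) (Fin a) ℂ) (B : Matrix (Fin b) (Fin b) ℂ)
    (i j : Fin b) : dirSum A B (Fin.natAdd a i) (Fin.natAdd a j) = B i j := by
  simp [dirSum]

theorem JordanPattern.dirSum {a b : ℕ} {A : Matrix (Fin a) (Fin a) ℂ}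
    {B : Matrix (Fin b) (Fin b) ℂ} (hA : JordanPattern A) (hB : JordanPattern B) :
    JordanPattern (dirSum A B) := by
  intro i j
  refine Fin.addCases (fun i => ?_) (fun i => ?_) i <;>
    refine Fin.addCases (fun j => ?_) (fun j => ?_) j
  · simp only [dirSum_inl_inl]
    intro h hne
    simpa using hA i j h fun e => hne (by rw [e])
  · simp [dirSum_inl_inr]
  · simp [dirSum_inr_inl]
  · simp only [dirSum_inr_inr]
    intro h hne
    have := hB i j h fun e => hne (by rw [e])
    refine ⟨?_, this.2⟩
    simp only [Fin.val_natAdd]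
    omega

theorem JordanPattern.of_dirSum_right {a b : ℕ} {A : Matrix (Fin a) (Fin a) ℂ}
    {B : Matrix (Fin b) (Fin b) ℂ} (h : JordanPattern (_root_.dirSum A B)) : JordanPattern B := by
  intro i j hij hne
  have := h (Fin.natAdd a i) (Fin.natAdd a j)
  simp only [dirSum_inr_inr, Fin.val_natAdd] at this
  have h2 := this hij fun e => hne (by simpa using e)
  exact ⟨by omega, h2.2⟩

theorem jordanPattern_zero (n : ℕ) : JordanPattern (0 : Matrix (Fin n) (Fin n) ℂ) :=
  fun _ _ h => absurd rfl h

theorem jordanPattern_fin_one (A : Matrix (Fin 1) (Fin 1) ℂ) : JordanPattern A :=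
  fun i j _ h => absurd (Subsingleton.elim i j) h

theorem JordanPattern.isUpperTriangular {n : ℕ} {J : Matrix (Fin n) (Fin n) ℂ}
    (hJ : JordanPattern J) : J.IsUpperTriangular := by
  intro i j hij
  simp only [id] at hij
  by_contra h
  have := (hJ i j h hij.ne').1
  omega

/-- Subtracting a nonzero scalar `N i i` from a nilpotent matrix leaves a unit, yet the triangular
result would have a zero on its diagonal. -/
theorem IsNilpotent.diag_eq_zero_of_isUpperTriangular {n : ℕ} {N : Matrix (Fin n) (Fin n) ℂ}
    (hN : IsNilpotent N) (hU : N.IsUpperTriangular) (i : Fin n) : N i i = 0 := by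
  by_contra h
  have hu : IsUnit (scalar (Fin n) (-N i i)) :=
    (IsUnit.mk0 _ (neg_ne_zero.2 h)).map (scalar (Fin n))
  have h1 := hN.isUnit_add_left_of_commute hu (scalar_commute _ (fun _ => Commute.all _ _) _).symm
  rw [isUnit_iff_isUnit_det, isUnit_iff_ne_zero] at h1
  apply h1
  have hT : (scalar (Fin n) (-N i i) + N).IsUpperTriangular := by
    intro a b hab
    have : a ≠ b := fun e => by simp [e] at hab
    simp [hU hab, diagonal_apply_ne _ this]
  rw [det_of_isUpperTriangular hT]
  exact Finset.prod_eq_zero (Finset.mem_univ i) (by simp)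

/-- In a decomposition of a Jordan matrix as diagonal plus nilpotent, the nilpotent part has zero
diagonal. -/
theorem JordanPattern.nilpotent_diag_eq_zero {n : ℕ} {D N : Matrix (Fin n) (Fin n) ℂ}
    (h : JordanPattern (D + N)) (hD : D.IsDiag) (hN : IsNilpotent N) (i : Fin n) : N i i = 0 := by
  refine hN.diag_eq_zero_of_isUpperTriangular (fun a b hab => ?_) i
  have h1 := h.isUpperTriangular hab
  have : a ≠ b := fun e => by simp [e] at hab
  simpa [hD this] using h1

theorem JordanPattern.smul_add {n : ℕ} {D N : Matrix (Fin n) (Fin n) ℂ}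
    (h : JordanPattern (D + N)) (hD : D.IsDiag) (hN : IsNilpotent N) (c : ℂ) :
    JordanPattern (c • D + N) := by
  intro i j hij hne
  have h1 := h i j
  simp only [Matrix.add_apply, Matrix.smul_apply, hD hne, h.nilpotent_diag_eq_zero hD hN,
    smul_zero, zero_add, add_zero] at h1 hij ⊢
  obtain ⟨h2, h3, h4⟩ := h1 hij hne
  exact ⟨h2, h3, by rw [h4]⟩

/-! ### Similarity across index types. -/

/-- Similarity of square matrices over `ℂ` with possibly different index types. -/
def SimilarTo {ι κ : Type*} [Fintype ι] [DecidableEq ι] [Fintype κ] [DecidableEq κ]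
    (A : Matrix ι ι ℂ) (B : Matrix κ κ ℂ) : Prop :=
  ∃ (C : Matrix ι κ ℂ) (C' : Matrix κ ι ℂ), C * C' = 1 ∧ C' * C = 1 ∧ C' * A * C = B

namespace SimilarTo

variable {ι κ τ υ : Type*} [Fintype ι] [DecidableEq ι] [Fintype κ] [DecidableEq κ]
  [Fintype τ] [DecidableEq τ] [Fintype υ] [DecidableEq υ]

theorem refl (A : Matrix ι ι ℂ) : SimilarTo A A := ⟨1, 1, by simp, by simp, by simp⟩

theorem trans {A : Matrix ι ι ℂ} {B : Matrix κ κ ℂ} {E : Matrix τ τ ℂ}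
    (h : SimilarTo A B) (h' : SimilarTo B E) : SimilarTo A E := by
  obtain ⟨P, P', h1, h2, h3⟩ := h
  obtain ⟨Q, Q', k1, k2, k3⟩ := h'
  refine ⟨P * Q, Q' * P', ?_, ?_, ?_⟩
  · rw [Matrix.mul_assoc, ← Matrix.mul_assoc Q, k1, Matrix.one_mul, h1]
  · rw [Matrix.mul_assoc, ← Matrix.mul_assoc P', h2, Matrix.one_mul, k2]
  · rw [← k3, ← h3]
    simp only [Matrix.mul_assoc]

theorem reindex (e : ι ≃ κ) (A : Matrix ι ι ℂ) : SimilarTo A (Matrix.reindex e e A) := by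
  refine ⟨(1 : Matrix ι ι ℂ).submatrix id e.symm, (1 : Matrix ι ι ℂ).submatrix e.symm id, ?_, ?_, ?_⟩
  · rw [submatrix_mul_equiv]; simp
  · ext i j; simp [Matrix.mul_apply, Matrix.one_apply]
  · ext i j; simp [Matrix.mul_apply, Matrix.one_apply]

theorem fromBlocks {A : Matrix ι ι ℂ} {B : Matrix κ κ ℂ} {A' : Matrix τ τ ℂ} {B' : Matrix υ υ ℂ}
    (h : SimilarTo A A') (h' : SimilarTo B B') :
    SimilarTo (fromBlocks A 0 0 B) (fromBlocks A' 0 0 B') := by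
  obtain ⟨P, P', h1, h2, h3⟩ := h
  obtain ⟨Q, Q', k1, k2, k3⟩ := h'
  refine ⟨Matrix.fromBlocks P 0 0 Q, Matrix.fromBlocks P' 0 0 Q', ?_, ?_, ?_⟩ <;>
    simp [fromBlocks_multiply, *]

theorem dirSum {a b : ℕ} {A : Matrix ι ι ℂ} {B : Matrix κ κ ℂ} {A' : Matrix (Fin a) (Fin a) ℂ}
    {B' : Matrix (Fin b) (Fin b) ℂ} (h : SimilarTo A A') (h' : SimilarTo B B') :
    SimilarTo (Matrix.fromBlocks A 0 0 B) (dirSum A' B') :=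
  (h.fromBlocks h').trans (reindex finSumFinEquiv _)

/-- A block upper triangular matrix with blocks satisfying a Sylvester equation splits. -/
theorem fromBlocks_zero₁₂ (A : Matrix ι ι ℂ) (B : Matrix κ κ ℂ) (u : Matrix ι κ ℂ) :
    SimilarTo (Matrix.fromBlocks A (u * B - A * u) 0 B) (Matrix.fromBlocks A 0 0 B) := by
  refine ⟨Matrix.fromBlocks 1 u 0 1, Matrix.fromBlocks 1 (-u) 0 1, ?_, ?_, ?_⟩
  · simp [fromBlocks_multiply]
  · simp [fromBlocks_multiply]
  · simp only [fromBlocks_multiply, Matrix.one_mul, Matrix.mul_one, Matrix.zero_mul,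
      Matrix.mul_zero, Matrix.neg_mul, add_zero, zero_add]
    congr 1
    abel

end SimilarTo

/-- Multiplying the superdiagonal of a Jordan matrix by a nonzero scalar gives a similar matrix. -/
theorem JordanPattern.similarTo_smul_add {n : ℕ} {D N : Matrix (Fin n) (Fin n) ℂ}
    (h : JordanPattern (D + N)) (hD : D.IsDiag) (hN : IsNilpotent N) {c : ℂ} (hc : c ≠ 0) :
    SimilarTo (c • (D + N)) (c • D + N) := by
  -- Conjugation multiplies entry `(i, j)` by `c ^ i * c⁻¹ ^ j`, which is `c⁻¹` on the
  -- superdiagonal.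
  refine ⟨diagonal fun i => c⁻¹ ^ (i : ℕ), diagonal fun i => c ^ (i : ℕ), ?_, ?_, ?_⟩
  · rw [diagonal_mul_diagonal, ← diagonal_one]
    congr 1; ext i
    rw [← mul_pow, inv_mul_cancel₀ hc, one_pow]
  · rw [diagonal_mul_diagonal, ← diagonal_one]
    congr 1; ext i
    rw [← mul_pow, mul_inv_cancel₀ hc, one_pow]
  · ext i j
    rw [mul_diagonal, diagonal_mul]
    have h1 := h i j
    rcases eq_or_ne i j with rfl | hne
    · simp only [Matrix.add_apply, Matrix.smul_apply, h.nilpotent_diag_eq_zero hD hN, add_zero]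
      rw [mul_right_comm, ← mul_pow, mul_inv_cancel₀ hc, one_pow, one_mul]
    · simp only [Matrix.add_apply, Matrix.smul_apply, hD hne, zero_add, smul_eq_mul,
        mul_zero] at h1 ⊢
      rcases eq_or_ne (N i j) 0 with h0 | h0
      · simp [h0]
      · rw [← (h1 h0 hne).1, pow_succ, inv_pow]
        field_simp

/-! ### Perron–Frobenius facts for constant row sums. -/

/-- In a row where `v` is minimal, the nonnegative terms `M a l * (v l - v m)` sum to zero, so `M`
vanishes from the minimum set to its complement. -/
theorem eq_of_mulVec_eq_smul_of_irreducible {n : ℕ} {M : Matrix (Fin n) (Fin n) ℝ} {ρ : ℝ}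
    (h0 : ∀ i j, 0 ≤ M i j) (hM : MatrixIrreducible M) (h1 : M *ᵥ 1 = ρ • 1)
    {v : Fin n → ℝ} (hv : M *ᵥ v = ρ • v) (i j : Fin n) : v i = v j := by
  obtain ⟨m, -, hm⟩ := Finset.exists_min_image Finset.univ v ⟨i, Finset.mem_univ i⟩
  suffices h : ∀ k, v k = v m by rw [h i, h j]
  by_contra! hk
  refine hM ⟨{k | v k = v m}, ⟨m, rfl⟩, hk, fun a ha b hb => ?_⟩
  have hsum : ∑ l, M a l * (v l - v m) = 0 := by
    have e1 := congrFun h1 a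
    have e2 := congrFun hv a
    simp only [mulVec, dotProduct, Pi.smul_apply, Pi.one_apply, smul_eq_mul, mul_one] at e1 e2
    simp only [mul_sub, Finset.sum_sub_distrib, ← Finset.sum_mul, e1, e2]
    rw [show v a = v m from ha, sub_self]
  have := (Finset.sum_eq_zero_iff_of_nonneg fun l hl =>
    mul_nonneg (h0 a l) (sub_nonneg.2 (hm l hl))).1 hsum b (Finset.mem_univ b)
  exact (mul_eq_zero.1 this).resolve_right (sub_ne_zero.2 hb)

theorem eq_of_map_mulVec_eq_smul_of_irreducible {n : ℕ} {M : Matrix (Fin n) (Fin n) ℝ} {ρ : ℝ}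
    (h0 : ∀ i j, 0 ≤ M i j) (hM : MatrixIrreducible M) (h1 : M *ᵥ 1 = ρ • 1)
    {v : Fin n → ℂ} (hv : M.map Complex.ofReal *ᵥ v = (ρ : ℂ) • v) (i j : Fin n) : v i = v j := by
  apply Complex.ext
  · refine eq_of_mulVec_eq_smul_of_irreducible h0 hM h1 (v := fun k => (v k).re) ?_ i j
    ext k
    simpa [mulVec, dotProduct] using congrArg Complex.re (congrFun hv k)
  · refine eq_of_mulVec_eq_smul_of_irreducible h0 hM h1 (v := fun k => (v k).im) ?_ i j
    ext k
    simpa [mulVec, dotProduct] using congrArg Complex.im (congrFun hv k)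

/-- Compare moduli in a row where `‖v‖` is largest. -/
theorem norm_le_of_map_mulVec_eq_smul {n : ℕ} {M : Matrix (Fin n) (Fin n) ℝ} {ρ : ℝ}
    (h0 : ∀ i j, 0 ≤ M i j) (h1 : M *ᵥ 1 = ρ • 1)
    {v : Fin n → ℂ} (hv0 : v ≠ 0) {z : ℂ} (hv : M.map Complex.ofReal *ᵥ v = z • v) : ‖z‖ ≤ ρ := by
  obtain ⟨k, hk⟩ := Function.ne_iff.1 hv0
  obtain ⟨m, -, hm⟩ := Finset.exists_max_image Finset.univ (fun i => ‖v i‖) ⟨k, Finset.mem_univ k⟩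
  have hpos : 0 < ‖v m‖ := (norm_pos_iff.2 hk).trans_le (hm k (Finset.mem_univ k))
  refine le_of_mul_le_mul_right ?_ hpos
  have e1 := congrFun h1 m
  have e2 := congrFun hv m
  simp only [mulVec, dotProduct, Pi.smul_apply, Pi.one_apply, smul_eq_mul, mul_one,
    map_apply] at e1 e2
  rw [← norm_mul, ← e2, ← e1, Finset.sum_mul]
  refine (norm_sum_le _ _).trans (Finset.sum_le_sum fun l hl => ?_)
  rw [norm_mul, Complex.norm_real, Real.norm_of_nonneg (h0 m l)]
  exact mul_le_mul_of_nonneg_left (hm l hl) (h0 m l)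

theorem rowSum_nonneg {n : ℕ} {M : Matrix (Fin n) (Fin n) ℝ} {ρ : ℝ}
    (h0 : ∀ i j, 0 ≤ M i j) (h1 : M *ᵥ 1 = ρ • 1) (i : Fin n) : 0 ≤ ρ := by
  have e1 := congrFun h1 i
  simp only [mulVec, dotProduct, Pi.smul_apply, Pi.one_apply, smul_eq_mul, mul_one] at e1
  rw [← e1]
  exact Finset.sum_nonneg fun j _ => h0 i j

/-! ### The Perron block and its complement. -/

section

variable {n m : ℕ} {M : Matrix (Fin n) (Fin n) ℝ} {ρ : ℝ} {K : Matrix (Fin m) (Fin m) ℂ}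

/-- The number `ρ + s` with `s ≥ 0` is not an eigenvalue of the complement of the Perron block. -/
theorem isUnit_sub_of_similarTo (h0 : ∀ i j, 0 ≤ M i j) (hM : MatrixIrreducible M)
    (h1 : M *ᵥ 1 = ρ • 1)
    (hS : SimilarTo (M.map Complex.ofReal) (fromBlocks !![(ρ : ℂ)] 0 0 K)) {s : ℝ} (hs : 0 ≤ s) :
    IsUnit (((ρ + s : ℝ) : ℂ) • (1 : Matrix (Fin m) (Fin m) ℂ) - K) := by
  rw [isUnit_iff_isUnit_det, isUnit_iff_ne_zero]
  intro hdet
  obtain ⟨u, hu0, hu⟩ := exists_mulVec_eq_zero_iff.2 hdet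
  rw [sub_mulVec, sub_eq_zero, smul_mulVec, one_mulVec] at hu
  obtain ⟨C, C', hC, hC', hJ⟩ := hS
  have hMC : M.map Complex.ofReal * C = C * fromBlocks !![(ρ : ℂ)] 0 0 K := by
    rw [← hJ, ← Matrix.mul_assoc, ← Matrix.mul_assoc, hC, Matrix.one_mul]
  have hinj : ∀ w, C *ᵥ w = 0 → w = 0 := by
    intro w hw
    rw [← one_mulVec w, ← hC', ← mulVec_mulVec, hw, mulVec_zero]
  have heig : ∀ (z : ℂ) w, fromBlocks !![(ρ : ℂ)] 0 0 K *ᵥ w = z • w →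
      M.map Complex.ofReal *ᵥ (C *ᵥ w) = z • (C *ᵥ w) := by
    intro z w hw
    rw [mulVec_mulVec, hMC, ← mulVec_mulVec, hw, mulVec_smul]
  have hw := heig ((ρ + s : ℝ) : ℂ) (Sum.elim 0 u) (by
    rw [fromBlocks_mulVec]
    ext (i | i)
    · simp
    · simp [← hu])
  have hw0 : C *ᵥ Sum.elim 0 u ≠ 0 := fun h => hu0 (by
    have := hinj _ h
    ext i
    exact congrFun this (Sum.inr i))
  have hle := norm_le_of_map_mulVec_eq_smul h0 h1 hw0 hw
  rw [Complex.norm_real] at hle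
  -- The modulus bound leaves only `s = 0`; then `(0, u)` and `(1, 0)` give two independent
  -- eigenvectors for `ρ`, both constant.
  have hs0 : s = 0 := le_antisymm (by linarith [Real.le_norm_self (ρ + s)]) hs
  rw [hs0, add_zero] at hw
  have hw1 := heig (ρ : ℂ) (Sum.elim 1 0) (by
    rw [fromBlocks_mulVec]
    ext (i | i)
    · simp [Fin.eq_zero i, dotProduct]
    · simp)
  obtain ⟨k, hk⟩ := Function.ne_iff.1 hw0
  have hc := eq_of_map_mulVec_eq_smul_of_irreducible h0 hM h1 hw
  have hc1 := eq_of_map_mulVec_eq_smul_of_irreducible h0 hM h1 hw1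
  -- The cross combination of two constant vectors vanishes.
  have := hinj ((C *ᵥ Sum.elim 0 u) k • (Sum.elim 1 0 : Fin 1 ⊕ Fin m → ℂ) -
      (C *ᵥ Sum.elim 1 0) k • (Sum.elim 0 u : Fin 1 ⊕ Fin m → ℂ)) (by
    ext i
    rw [mulVec_sub, mulVec_smul, mulVec_smul]
    simp only [Pi.sub_apply, Pi.smul_apply, smul_eq_mul, hc i k, hc1 i k, Pi.zero_apply]
    ring)
  have := congrFun this (Sum.inl 0)
  simp only [Pi.sub_apply, Pi.smul_apply, Sum.elim_inl, Pi.one_apply, Pi.zero_apply, smul_eq_mul,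
    mul_one, mul_zero, sub_zero] at this
  exact hk this

/-- A basis starting with the all ones vector, followed by vectors with zero sum, in which `M`
and the all ones matrix are simultaneously block triangular. -/
theorem exists_simultaneous_block_form (h0 : ∀ i j, 0 ≤ M i j) (hM : MatrixIrreducible M)
    (h1 : M *ᵥ 1 = ρ • 1) (hn : n ≠ 0)
    (hS : SimilarTo (M.map Complex.ofReal) (fromBlocks !![(ρ : ℂ)] 0 0 K)) :
    ∃ (P : Matrix (Fin n) (Fin 1 ⊕ Fin m) ℂ) (P' : Matrix (Fin 1 ⊕ Fin m) (Fin n) ℂ)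
      (r : Matrix (Fin 1) (Fin m) ℂ), P * P' = 1 ∧ P' * P = 1 ∧
      P' * M.map Complex.ofReal * P = fromBlocks !![(ρ : ℂ)] r 0 K ∧
      P' * (allOnes n).map Complex.ofReal * P = fromBlocks !![(n : ℂ)] 0 0 0 := by
  obtain ⟨C, C', hC, hC', hJ⟩ := hS
  have hnC : (n : ℂ) ≠ 0 := Nat.cast_ne_zero.2 hn
  have hMC : M.map Complex.ofReal * C = C * fromBlocks !![(ρ : ℂ)] 0 0 K := by
    rw [← hJ, ← Matrix.mul_assoc, ← Matrix.mul_assoc, hC, Matrix.one_mul]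
  have hcol : M.map Complex.ofReal *ᵥ (C *ᵥ Sum.elim 1 0) = (ρ : ℂ) • (C *ᵥ Sum.elim 1 0) := by
    rw [mulVec_mulVec, hMC, ← mulVec_mulVec, fromBlocks_mulVec, ← mulVec_smul]
    congr 1
    ext (i | i)
    · simp [Fin.eq_zero i, dotProduct]
    · simp
  have hconst := eq_of_map_mulVec_eq_smul_of_irreducible h0 hM h1 hcol
  have hcol' : ∀ i, (C *ᵥ Sum.elim 1 0) i = C i (Sum.inl 0) := by
    intro i; simp [mulVec, dotProduct]
  simp only [hcol'] at hconst
  obtain ⟨c, hc⟩ : ∃ c, ∀ i, C i (Sum.inl 0) = c := ⟨C ⟨0, by omega⟩ (Sum.inl 0), fun i => hconst _ _⟩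
  have hc0 : c ≠ 0 := by
    rintro rfl
    have := congrFun (congrFun hC' (Sum.inl 0)) (Sum.inl 0)
    simp [Matrix.mul_apply, hc] at this
  -- The first column of `C` is constantly `c`; adding `t` times it makes every other column sum to
  -- zero, and `c⁻¹` rescales it to ones.
  let t : Matrix (Fin 1) (Fin m) ℂ := of fun _ j => -((n : ℂ) * c)⁻¹ * ∑ i, C i (Sum.inr j)
  let U : Matrix (Fin 1 ⊕ Fin m) (Fin 1 ⊕ Fin m) ℂ := fromBlocks (c⁻¹ • 1) t 0 1
  let U' : Matrix (Fin 1 ⊕ Fin m) (Fin 1 ⊕ Fin m) ℂ := fromBlocks (c • 1) (-(c • t)) 0 1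
  have hU : U * U' = 1 := by
    simp [U, U', fromBlocks_multiply, hc0]
  have hU' : U' * U = 1 := by
    simp [U, U', fromBlocks_multiply, hc0]
  have hP1 : ∀ i, (C * U) i (Sum.inl 0) = 1 := by
    intro i
    simp [U, Matrix.mul_apply, hc, hc0]
  have hP2 : ∀ j, ∑ i, (C * U) i (Sum.inr j) = 0 := by
    intro j
    simp only [Matrix.mul_apply, U, Fintype.sum_sum_type, Finset.univ_unique, Fin.default_eq_zero,
      Finset.sum_singleton, fromBlocks_apply₁₂, fromBlocks_apply₂₂, hc, Matrix.one_apply, mul_ite,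
      mul_one, mul_zero, Finset.sum_ite_eq', Finset.mem_univ, if_true, Finset.sum_add_distrib,
      Finset.sum_const, Finset.card_univ, Fintype.card_fin, nsmul_eq_mul, t, of_apply]
    field_simp
    ring
  refine ⟨C * U, U' * C', c • (!![(ρ : ℂ)] * t) - c • t * K, ?_, ?_, ?_, ?_⟩
  · rw [Matrix.mul_assoc, ← Matrix.mul_assoc U, hU, Matrix.one_mul, hC]
  · rw [Matrix.mul_assoc, ← Matrix.mul_assoc C', hC', Matrix.one_mul, hU']
  · have : U' * C' * M.map Complex.ofReal * (C * U) =
        U' * (C' * M.map Complex.ofReal * C) * U := by simp only [Matrix.mul_assoc]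
    rw [this, hJ]
    generalize !![(ρ : ℂ)] = R
    simp [U, U', fromBlocks_multiply, hc0, sub_eq_add_neg]
  · have hE : (allOnes n).map Complex.ofReal * (C * U) =
        C * U * fromBlocks !![(n : ℂ)] 0 0 (0 : Matrix (Fin m) (Fin m) ℂ) := by
      ext i (j | j)
      · rw [Fin.eq_zero j, Matrix.mul_apply, Matrix.mul_apply]
        simp [allOnes, hP1]
      · rw [Matrix.mul_apply, Matrix.mul_apply]
        simp [allOnes, hP2]
    have hPP : U' * C' * (C * U) = 1 := by
      rw [Matrix.mul_assoc, ← Matrix.mul_assoc C', hC', Matrix.one_mul, hU']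
    rw [Matrix.mul_assoc, hE, ← Matrix.mul_assoc, hPP, Matrix.one_mul]

end

/-! ### Block form of the Kronecker sum. -/

/-- The blocks of a product of two sums with one-point first summands. -/
def prodSumEquiv (α β : Type*) :
    (Fin 1 ⊕ α) × (Fin 1 ⊕ β) ≃ Fin 1 ⊕ (β ⊕ (α ⊕ α × β)) where
  toFun
    | (Sum.inl _, Sum.inl _) => Sum.inl 0
    | (Sum.inl _, Sum.inr b) => Sum.inr (Sum.inl b)
    | (Sum.inr a, Sum.inl _) => Sum.inr (Sum.inr (Sum.inl a))
    | (Sum.inr a, Sum.inr b) => Sum.inr (Sum.inr (Sum.inr (a, b)))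
  invFun
    | Sum.inl _ => (Sum.inl 0, Sum.inl 0)
    | Sum.inr (Sum.inl b) => (Sum.inl 0, Sum.inr b)
    | Sum.inr (Sum.inr (Sum.inl a)) => (Sum.inr a, Sum.inl 0)
    | Sum.inr (Sum.inr (Sum.inr (a, b))) => (Sum.inr a, Sum.inr b)
  left_inv := by
    rintro ⟨x | a, y | b⟩ <;> simp [Fin.eq_zero]
  right_inv := by
    rintro (x | b | a | ⟨a, b⟩) <;> simp [Fin.eq_zero]

theorem exists_mul_sub_smul_eq {m : ℕ} {K : Matrix (Fin m) (Fin m) ℂ} {θ : ℂ}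
    (h : IsUnit (θ • (1 : Matrix (Fin m) (Fin m) ℂ) - K)) (w : Matrix (Fin 1) (Fin m) ℂ) :
    ∃ u : Matrix (Fin 1) (Fin m) ℂ, u * K - θ • u = w := by
  obtain ⟨V, hV⟩ := h.exists_left_inv
  refine ⟨-(w * V), ?_⟩
  have : -(w * V) * K - θ • -(w * V) = w * (V * (θ • 1 - K)) := by
    simp only [Matrix.mul_sub, Matrix.mul_smul, Matrix.mul_one, Matrix.neg_mul, smul_neg,
      Matrix.mul_assoc]
    abel
  rw [this, hV, Matrix.mul_one]

theorem boxJ_similarTo {n n' m m' : ℕ} {M : Matrix (Fin n) (Fin n) ℝ}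
    {M' : Matrix (Fin n') (Fin n') ℝ} {ρ ρ' : ℝ} {K : Matrix (Fin m) (Fin m) ℂ}
    {K' : Matrix (Fin m') (Fin m') ℂ} (hn : n ≠ 0) (hn' : n' ≠ 0)
    (h0 : ∀ i j, 0 ≤ M i j) (h0' : ∀ i j, 0 ≤ M' i j)
    (hM : MatrixIrreducible M) (hM' : MatrixIrreducible M')
    (h1 : M *ᵥ 1 = ρ • 1) (h1' : M' *ᵥ 1 = ρ' • 1)
    (hS : SimilarTo (M.map Complex.ofReal) (fromBlocks !![(ρ : ℂ)] 0 0 K))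
    (hS' : SimilarTo (M'.map Complex.ofReal) (fromBlocks !![(ρ' : ℂ)] 0 0 K')) :
    SimilarTo ((boxJ M M').map Complex.ofReal)
      (fromBlocks !![(n : ℂ) * (ρ' : ℂ) + (n' : ℂ) * (ρ : ℂ)] 0 0
        (fromBlocks ((n : ℂ) • K') 0 0
          (fromBlocks ((n' : ℂ) • K) 0 0 (0 : Matrix (Fin m × Fin m') (Fin m × Fin m') ℂ)))) := by
  have hnC : (n : ℂ) ≠ 0 := Nat.cast_ne_zero.2 hn
  have hnC' : (n' : ℂ) ≠ 0 := Nat.cast_ne_zero.2 hn'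
  have hρ := rowSum_nonneg h0 h1 ⟨0, Nat.pos_of_ne_zero hn⟩
  have hρ' := rowSum_nonneg h0' h1' ⟨0, Nat.pos_of_ne_zero hn'⟩
  set θ : ℂ := (n : ℂ) * (ρ' : ℂ) + (n' : ℂ) * (ρ : ℂ) with hθ
  have hunit : IsUnit (θ • (1 : Matrix (Fin m) (Fin m) ℂ) - (n' : ℂ) • K) := by
    -- With this `s`, `n' * (ρ + s) = θ`.
    have := (isUnit_sub_of_similarTo h0 hM h1 hS (s := n * ρ' / n') (by positivity)).smul
      (Units.mk0 (n' : ℂ) hnC')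
    convert this using 1
    rw [Units.smul_def, Units.val_mk0, smul_sub, smul_smul, hθ]
    congr 2
    push_cast
    field_simp
    ring
  have hunit' : IsUnit (θ • (1 : Matrix (Fin m') (Fin m') ℂ) - (n : ℂ) • K') := by
    have := (isUnit_sub_of_similarTo h0' hM' h1' hS' (s := n' * ρ / n) (by positivity)).smul
      (Units.mk0 (n : ℂ) hnC)
    convert this using 1
    rw [Units.smul_def, Units.val_mk0, smul_sub, smul_smul, hθ]
    congr 2
    push_cast
    field_simp
  obtain ⟨P, Q, r, hPQ, hQP, hPM, hPJ⟩ := exists_simultaneous_block_form h0 hM h1 hn hS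
  obtain ⟨P', Q', r', hPQ', hQP', hPM', hPJ'⟩ := exists_simultaneous_block_form h0' hM' h1' hn' hS'
  obtain ⟨u, hu⟩ := exists_mul_sub_smul_eq hunit ((n' : ℂ) • r)
  obtain ⟨u', hu'⟩ := exists_mul_sub_smul_eq hunit' ((n : ℂ) • r')
  set B := fromBlocks ((n : ℂ) • K') 0 0
          (fromBlocks ((n' : ℂ) • K) 0 0 (0 : Matrix (Fin m × Fin m') (Fin m × Fin m') ℂ)) with hB
  have hbox : (boxJ M M').map Complex.ofReal =
      M.map Complex.ofReal ⊗ₖ (allOnes n').map Complex.ofReal +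
        (allOnes n).map Complex.ofReal ⊗ₖ M'.map Complex.ofReal := by
    ext i j
    simp [boxJ, kroneckerMap_apply]
  have step1 : SimilarTo ((boxJ M M').map Complex.ofReal)
      (fromBlocks !![(ρ : ℂ)] r 0 K ⊗ₖ fromBlocks !![(n' : ℂ)] 0 0 (0 : Matrix (Fin m') (Fin m') ℂ) +
        fromBlocks !![(n : ℂ)] 0 0 (0 : Matrix (Fin m) (Fin m) ℂ) ⊗ₖ
          fromBlocks !![(ρ' : ℂ)] r' 0 K') := by
    refine ⟨P ⊗ₖ P', Q ⊗ₖ Q', ?_, ?_, ?_⟩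
    · rw [← mul_kronecker_mul, hPQ, hPQ', one_kronecker_one]
    · rw [← mul_kronecker_mul, hQP, hQP', one_kronecker_one]
    · rw [hbox, Matrix.mul_add, Matrix.add_mul, ← mul_kronecker_mul, ← mul_kronecker_mul,
        ← mul_kronecker_mul, ← mul_kronecker_mul, hPM, hPJ, hPM', hPJ']
  -- The top row is already zero over the zero block, so the last component can be `0` even if `θ =
  -- 0`.
  let U : Matrix (Fin 1) (Fin m' ⊕ (Fin m ⊕ Fin m × Fin m')) ℂ := fromCols u' (fromCols u 0)
  have step2 := SimilarTo.fromBlocks_zero₁₂ !![θ] B U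
  refine (step1.trans (SimilarTo.reindex (prodSumEquiv _ _) _)).trans ?_
  convert step2 using 1
  have hU : U * B - !![θ] * U = fromCols ((n : ℂ) • r') (fromCols ((n' : ℂ) • r) 0) := by
    have hθU : !![θ] * U = θ • U := by
      ext i j
      simp [Matrix.mul_apply, Fin.eq_zero i]
    rw [hθU, ← hu, ← hu']
    simp only [U, hB, fromCols_mul_fromBlocks, Matrix.mul_zero, add_zero, zero_add]
    ext i (j | j | j) <;> simp
  rw [hU]
  ext (i | i | i | i) (j | j | j | j) <;>
    simp [prodSumEquiv, kroneckerMap_apply, hB, hθ, Fin.eq_zero] <;> ring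

theorem mainTheorem1 {n n' : ℕ}
    (M : Matrix (Fin n) (Fin n) ℝ) (M' : Matrix (Fin n') (Fin n') ℝ) (ρ ρ' : ℝ)
    (hM_nonneg : ∀ i j, 0 ≤ M i j) (hM'_nonneg : ∀ i j, 0 ≤ M' i j)
    (hM_irr : MatrixIrreducible M) (hM'_irr : MatrixIrreducible M')
    (hM_row : M *ᵥ 1 = ρ • 1) (hM'_row : M' *ᵥ 1 = ρ' • 1)
    (D N : Matrix (Fin (n - 1)) (Fin (n - 1)) ℂ)
    (D' N' : Matrix (Fin (n' - 1)) (Fin (n' - 1)) ℂ)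
    (hD : D.IsDiag) (hN : IsNilpotent N) (hD' : D'.IsDiag) (hN' : IsNilpotent N')
    (hJ : IsJordanForm M (dirSum !![(ρ : ℂ)] (D + N)))
    (hJ' : IsJordanForm M' (dirSum !![(ρ' : ℂ)] (D' + N'))) :
    IsJordanForm (boxJ M M')
      (dirSum !![(n : ℂ) * (ρ' : ℂ) + (n' : ℂ) * (ρ : ℂ)]
        (dirSum ((n : ℂ) • D' + N')
          (dirSum ((n' : ℂ) • D + N)
            (0 : Matrix (Fin ((n - 1) * (n' - 1))) (Fin ((n - 1) * (n' - 1))) ℂ)))) := by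
  -- Truncated subtraction makes `n - 1 = 0` at `n = 0`; invertibility of `C` excludes that case,
  -- since `J` has order at least 1.
  have size_ne_zero : ∀ {p q : ℕ} {A : Matrix (Fin p) (Fin p) ℝ}
      {X : Matrix (Fin (1 + q)) (Fin (1 + q)) ℂ}, IsJordanForm A X → p ≠ 0 := by
    rintro p q A X ⟨-, C, C', -, hC', -⟩ rfl
    have := congrFun (congrFun hC' (Fin.castAdd q 0)) (Fin.castAdd q 0)
    simp [Matrix.mul_apply] at this
  have similarTo_fromBlocks : ∀ {p q : ℕ} {A : Matrix (Fin p) (Fin p) ℝ}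
      {X : Matrix (Fin 1) (Fin 1) ℂ} {Y : Matrix (Fin q) (Fin q) ℂ}, IsJordanForm A (dirSum X Y) →
      SimilarTo (A.map Complex.ofReal) (fromBlocks X 0 0 Y) := by
    intro p q A X Y h
    have h1 : SimilarTo (A.map Complex.ofReal) (dirSum X Y) := h.2
    have h2 := h1.trans (SimilarTo.reindex finSumFinEquiv.symm _)
    simpa [dirSum] using h2
  have hn := size_ne_zero hJ
  have hn' := size_ne_zero hJ'
  have hK := hJ.1.jordanPattern.of_dirSum_right
  have hK' := hJ'.1.jordanPattern.of_dirSum_right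
  refine ⟨JordanPattern.isJordanMatrix ?_, ?_⟩
  · exact (jordanPattern_fin_one _).dirSum ((hK'.smul_add hD' hN' _).dirSum
      ((hK.smul_add hD hN _).dirSum (jordanPattern_zero _)))
  · have hzero : SimilarTo (0 : Matrix (Fin (n - 1) × Fin (n' - 1)) (Fin (n - 1) × Fin (n' - 1)) ℂ)
        (0 : Matrix (Fin ((n - 1) * (n' - 1))) (Fin ((n - 1) * (n' - 1))) ℂ) :=
      SimilarTo.reindex finProdFinEquiv 0
    exact (boxJ_similarTo hn hn' hM_nonneg hM'_nonneg hM_irr hM'_irr hM_row hM'_row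
      (similarTo_fromBlocks hJ) (similarTo_fromBlocks hJ')).trans
      ((SimilarTo.refl _).dirSum
        ((hK'.similarTo_smul_add hD' hN' (Nat.cast_ne_zero.2 hn)).dirSum
          ((hK.similarTo_smul_add hD hN (Nat.cast_ne_zero.2 hn')).dirSum hzero)))
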